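/- For a finite group $G$ let $\Pr(G)=|\{(x,y)\in G\times G : xy=yx\}|/|G|^2$, let $b(G)$ be the size of a largest conjugacy class of $G$, let $Z(G)$ be its center and $\gamma_2(G)$ its commutator subgroup. Two finite groups $G,H$ are *isoclinic* if there are isomorphisms $\alpha:G/Z(G)\to H/Z(H)$ and $\beta:\gamma_2(G)\to\gamma_2(H)$ such that $\beta([x,y])=[x',y']$ whenever $x,y\in G$, $x',y'\in H$ satisfy $\alpha(xZ(G))=x'Z(H)$ and $\alpha(yZ(G))=y'Z(H)$. A finite group $H$ is a *Camina group* if the conjugacy class of $x$ in $H$ equals $x\gamma_2(H)$ for every $x\in H\setminus\gamma_2(H)$. A $p$-group $H$ is *special* if $Z(H)=\gamma_2(H)=\Phi(H)$, where $\Phi(H)$ is the Frattini subgroup. **Proposition.** Let $G$ be a non-abelian finite group such that $$\Pr(G)=\frac{1}{b(G)}\left(1+\frac{b(G)-1}{|G:Z(G)|}\right).$$ Then there are a prime $p$ and an integer $r\ge 1$ such that $G$ is isoclinic to a finite $p$-group whose set of conjugacy class sizes is exactly $\{1,p^r\}$. Moreover, if $b(G)=|\gamma_2(G)|$, then $G$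 is isoclinic to a finite Camina special $p$-group (for the same prime $p$). -/

import Mathlib

open scoped commutatorElement

universe u

/-- The commutator map `a_G : G/Z(G) × G/Z(G) → γ₂(G)`, `(xZ(G), yZ(G)) ↦ [x, y]`. -/
def commutatorMap (G : Type*) [Group G] (x y : G ⧸ Subgroup.center G) : commutator G :=
  Quotient.liftOn₂' x y
    (fun a b => ⟨⁅a, b⁆, Subgroup.commutator_mem_commutator (Subgroup.mem_top a)
      (Subgroup.mem_top b)⟩)
    (by
      intro a₁ b₁ a₂ b₂ ha hb
      rw [QuotientGroup.leftRel_apply] at ha hb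
      obtain ⟨z, hz, rfl⟩ : ∃ z ∈ Subgroup.center G, a₂ = a₁ * z := ⟨_, ha, by group⟩
      obtain ⟨w, hw, rfl⟩ : ∃ w ∈ Subgroup.center G, b₂ = b₁ * w := ⟨_, hb, by group⟩
      rw [Subgroup.mem_center_iff] at hz hw
      refine Subtype.ext ?_
      have e1 : ⁅a₁ * z, b₁ * w⁆ = ⁅a₁, b₁ * w⁆ := by
        have h := hz (b₁ * w)
        calc ⁅a₁ * z, b₁ * w⁆ = a₁ * (z * (b₁ * w)) * z⁻¹ * a₁⁻¹ * (b₁ * w)⁻¹ := by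
              rw [commutatorElement_def]; group
          _ = a₁ * ((b₁ * w) * z) * z⁻¹ * a₁⁻¹ * (b₁ * w)⁻¹ := by rw [h]
          _ = ⁅a₁, b₁ * w⁆ := by rw [commutatorElement_def]; group
      have e2 : ⁅a₁, b₁ * w⁆ = ⁅a₁, b₁⁆ := by
        have h := hw a₁⁻¹
        calc ⁅a₁, b₁ * w⁆ = a₁ * b₁ * (w * a₁⁻¹) * w⁻¹ * b₁⁻¹ := by
              rw [commutatorElement_def]; group
          _ = a₁ * b₁ * (a₁⁻¹ * w) * w⁻¹ * b₁⁻¹ := by rw [h]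
          _ = ⁅a₁, b₁⁆ := by rw [commutatorElement_def]; group
      exact (e1.trans e2).symm)

theorem commutatorMap_mk {G : Type*} [Group G] (a b : G) :
    (commutatorMap G (a : G ⧸ Subgroup.center G) (b : G ⧸ Subgroup.center G) : G) = ⁅a, b⁆ :=
  rfl

/-- `G` and `H` are isoclinic: there are isomorphisms `α : G/Z(G) ≃ H/Z(H)` and
`β : γ₂(G) ≃ γ₂(H)` that are compatible with the commutator maps. -/
def IsIsoclinic (G H : Type*) [Group G] [Group H] : Prop :=
  ∃ (α : (G ⧸ Subgroup.center G) ≃* (H ⧸ Subgroup.center H)) (β : commutator G ≃* commutator H),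
    ∀ x y : G ⧸ Subgroup.center G, β (commutatorMap G x y) = commutatorMap H (α x) (α y)

/-- The set of conjugacy class sizes of `G`. -/
def conjClassSizes (G : Type*) [Group G] : Set ℕ :=
  Set.range fun x : G => (conjugatesOf x).ncard

/-- The size `b(G)` of a largest conjugacy class of the finite group `G`. -/
noncomputable def maxConjClassSize (G : Type*) [Group G] : ℕ :=
  sSup (conjClassSizes G)

theorem isGreatest_maxConjClassSize (G : Type*) [Group G] [Finite G] :
    IsGreatest (conjClassSizes G) (maxConjClassSize G) :=
  have hfin : (conjClassSizes G).Finite := Set.finite_range _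
  have hne : (conjClassSizes G).Nonempty := Set.range_nonempty _
  ⟨Nat.sSup_mem hne hfin.bddAbove, fun _ hn => le_csSup hfin.bddAbove hn⟩

/-- `G` is a Camina group: `x^G = x γ₂(G)` for all `x ∈ G ∖ γ₂(G)`. -/
def IsCamina (G : Type*) [Group G] : Prop :=
  ∀ x : G, x ∉ commutator G → conjugatesOf x = (fun c => x * c) '' (commutator G : Set G)

/-- `G` is a special `p`-group: a `p`-group with `Z(G) = γ₂(G) = Φ(G)`. -/
structure IsSpecialPGroup (p : ℕ) (G : Type*) [Group G] : Prop where
  isPGroup : IsPGroup p G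
  center_eq_commutator : Subgroup.center G = commutator G
  commutator_eq_frattini : commutator G = frattini G

open Subgroup

/-! Counting commuting pairs gives `∑ |C(x)|`. Central elements contribute `|G|` and the others at
least `|G| / b`. The hypothesis is equality in the resulting bound, so every noncentral class has
size `m = b` (`index_centralizer_of_commProb_eq`).

Itô's theorem (`isPGroup_quotient_center`) then makes `G/Z` a `p`-group. Put `c = |C(x) : Z|`, so `c
* m = |G : Z|`. If two primes divided `|G : Z|`, distinct centralizers of noncentral elements would
be abelian and meet in `Z`, forcing `c ≤ m`. Letting a Sylow `r`-subgroup act on a noncentral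
`q`-element modulo `Z` bounds the `r`-part of `m` strictly by the `q`-part of `c`, for all primes `r
≠ q`, and hence `m < c`. With `G/Z` a `p`-group, `G = P Z` for a Sylow `p`-subgroup `P`, which is
isoclinic to `G` and has the same class sizes.

If moreover `b = |γ₂(G)|`, then `g ↦ [x, g]` is onto `γ₂(G)` for each noncentral `x`. This forces
class two and exponent `p` for `V = G/Z` and `W = γ₂(G)`, so commutation is an alternating bilinear
map `V × V → W`. Writing it as `f u v - f v u`, the central extension of `V` by `W` with cocycle `f`
has the same commutator map and is Camina and special. -/

/-! ### Commuting probability and class sizes -/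

theorem ncard_conjugatesOf {G : Type*} [Group G] [Finite G] (x : G) :
    (conjugatesOf x).ncard = (centralizer {x}).index := by
  have h : conjugatesOf x = MulAction.orbit (ConjAct G) x := by
    ext y
    rw [ConjAct.mem_orbit_conjAct]
    exact isConj_comm
  rw [h, ← MulAction.index_stabilizer, ConjAct.stabilizer_eq_centralizer]
  rfl

theorem centralizer_singleton_eq_top_iff {G : Type*} [Group G] {x : G} :
    centralizer {x} = ⊤ ↔ x ∈ center G := by
  rw [centralizer_eq_top_iff_subset, Set.singleton_subset_iff, SetLike.mem_coe]

theorem card_commute_eq_sum {G : Type*} [Group G] [Fintype G] :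
    Nat.card {p : G × G // Commute p.1 p.2} = ∑ x : G, Nat.card (centralizer {x}) := by
  rw [← Nat.card_sigma]
  refine Nat.card_congr ⟨fun p => ⟨p.1.1, p.1.2, mem_centralizer_singleton_iff.2 p.2.symm⟩,
    fun s => ⟨(s.1, s.2.1), (mem_centralizer_singleton_iff.1 s.2.2).symm⟩,
    fun _ => rfl, fun _ => rfl⟩

/-- The lower bound for the commuting probability in terms of the largest class size is attained
only if all noncentral classes have the same size. -/
theorem index_centralizer_of_commProb_eq {G : Type*} [Group G] [Finite G]
    (hPr : commProb G = 1 / (maxConjClassSize G : ℚ) *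
      (1 + ((maxConjClassSize G : ℚ) - 1) / ((center G).index : ℚ))) :
    ∀ x ∉ center G, (centralizer {x}).index = maxConjClassSize G := by
  classical
  have := Fintype.ofFinite G
  set b := maxConjClassSize G with hb
  have hle : ∀ x : G, (centralizer {x}).index ≤ b := fun x =>
    (isGreatest_maxConjClassSize G).2 ⟨x, ncard_conjugatesOf x⟩
  have hb0 : (0 : ℚ) < b := by
    have := hle 1
    have h1 : (centralizer {(1 : G)}).index ≠ 0 := FiniteIndex.index_ne_zero
    exact_mod_cast (Nat.pos_of_ne_zero h1).trans_le this
  have hN0 : (0 : ℚ) < Nat.card G := by exact_mod_cast Nat.card_pos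
  have hi0 : (0 : ℚ) < (center G).index := by
    exact_mod_cast Nat.pos_of_ne_zero FiniteIndex.index_ne_zero
  have hmul : ∀ x : G, (Nat.card (centralizer {x}) : ℚ) * (centralizer {x}).index = Nat.card G :=
    fun x => by exact_mod_cast card_mul_index _
  have hZ : (Nat.card (center G) : ℚ) * (center G).index = Nat.card G := by
    exact_mod_cast card_mul_index _
  let f : G → ℚ := fun x => Nat.card (centralizer {x})
  -- The pointwise lower bound for `|C(x)|`: `|G| / b` off the center, `|G|` on it.
  let g : G → ℚ := fun x =>
    (Nat.card G : ℚ) / b + if x ∈ center G then (Nat.card G : ℚ) - (Nat.card G : ℚ) / b else 0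
  have hfg : ∀ x ∈ Finset.univ, g x ≤ f x := by
    intro x _
    by_cases hx : x ∈ center G
    · simp only [f, g, hx, if_true, centralizer_singleton_eq_top_iff.2 hx]
      simp
    · simp only [f, g, hx, if_false, add_zero]
      rw [div_le_iff₀ hb0, ← hmul x]
      gcongr
      exact_mod_cast hle x
  have hsum : ∑ x, g x = ∑ x, f x := by
    have h1 : ∑ x, f x = commProb G * (Nat.card G : ℚ) ^ 2 := by
      rw [commProb_def, div_mul_cancel₀ _ (pow_ne_zero _ hN0.ne'), card_commute_eq_sum]
      push_cast
      rfl
    have h2 : ∑ x : G, (if x ∈ center G then (Nat.card G : ℚ) - (Nat.card G : ℚ) / b else 0) =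
        Nat.card (center G) * ((Nat.card G : ℚ) - (Nat.card G : ℚ) / b) := by
      rw [← Finset.sum_filter, Finset.sum_const, nsmul_eq_mul,
        Nat.card_eq_fintype_card (α := center G), Fintype.card_subtype]
    rw [h1, hPr, Finset.sum_add_distrib, h2, Finset.sum_const, Finset.card_univ, nsmul_eq_mul,
      ← Nat.card_eq_fintype_card, ← hZ]
    field_simp
  intro x hx
  have := (Finset.sum_eq_sum_iff_of_le hfg).1 hsum x (Finset.mem_univ x)
  simp only [f, g, hx, if_false, add_zero] at this
  rw [div_eq_iff hb0.ne', ← hmul x] at this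
  have hc : (Nat.card (centralizer {x}) : ℚ) ≠ 0 := by exact_mod_cast Nat.card_pos.ne'
  exact_mod_cast mul_left_cancel₀ hc this

/-! ### Primary elements outside the center -/

/-- If `q` divides the index of `Z` in `K`, then `K` has a `q`-element outside `Z`. -/
theorem exists_pow_eq_one_of_dvd_relIndex {G : Type*} [Group G] [Finite G] {Z K : Subgroup G}
    {q : ℕ} (hq : q.Prime) (h : q ∣ Z.relIndex K) :
    ∃ y ∈ K, y ∉ Z ∧ ∃ k, y ^ q ^ k = 1 := by
  have := Fact.mk hq
  by_contra! hcon
  -- If every `q`-element of `K` were in `Z`, then `S ≤ Z` and `|K : Z|` would divide `|K : S|`,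
  -- which is prime to `q`.
  let S : Sylow q K := default
  refine S.not_dvd_index (h.trans (index_dvd_of_le (K := Z.subgroupOf K) fun s hs => ?_))
  rw [mem_subgroupOf]
  by_contra hs'
  obtain ⟨k, hk⟩ := S.2 ⟨s, hs⟩
  refine hcon s s.2 hs' k ?_
  have := congrArg (fun t : S => ((t : K) : G)) hk
  simpa using this

theorem exists_pow_eq_one_of_dvd_index {G : Type*} [Group G] [Finite G] {Z : Subgroup G}
    {q : ℕ} (hq : q.Prime) (h : q ∣ Z.index) : ∃ y ∉ Z, ∃ k, y ^ q ^ k = 1 := by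
  obtain ⟨y, -, h1, h2⟩ := exists_pow_eq_one_of_dvd_relIndex (K := ⊤) hq (by simpa using h)
  exact ⟨y, h1, h2⟩

theorem card_map_mk_center {G : Type*} [Group G] (K : Subgroup G) :
    Nat.card (K.map (QuotientGroup.mk' (center G))) = (center G).relIndex K := by
  rw [← relIndex_ker, QuotientGroup.ker_mk']

theorem relIndex_centralizer_mul {G : Type*} [Group G] {m : ℕ}
    (h : ∀ x ∉ center G, (centralizer {x}).index = m) {x : G}
    (hx : x ∉ center G) : (center G).relIndex (centralizer {x}) * m = (center G).index := by
  rw [← h x hx, relIndex_mul_index (center_le_centralizer _)]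

/-! ### Centralizers when all noncentral classes have equal size -/

section EqualClasses

variable {G : Type*} [Group G] [Finite G] {m : ℕ}

theorem centralizer_eq_of_le (h : ∀ x ∉ center G, (centralizer {x}).index = m) {x y : G}
    (hx : x ∉ center G) (hy : y ∉ center G) (hle : centralizer {x} ≤ centralizer {y}) :
    centralizer {x} = centralizer {y} := by
  by_contra hne
  exact (index_strictAnti (lt_of_le_of_ne hle hne)).ne ((h y hy).trans (h x hx).symm)

theorem centralizer_eq_of_mem_zpowers (h : ∀ x ∉ center G, (centralizer {x}).index = m) {x y : G}
    (hx : x ∉ center G) (hy : y ∉ center G) (hle : y ∈ zpowers x) :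
    centralizer {x} = centralizer {y} := by
  refine centralizer_eq_of_le h hx hy fun g hg => ?_
  obtain ⟨k, rfl⟩ := hle
  rw [mem_centralizer_singleton_iff] at hg ⊢
  exact (Commute.zpow_right hg k)

/-- By coprimality both `x` and `y` are powers of `x * y`. So `C(x * y)` is contained in `C(x)` and
in `C(y)`, and equality of indices turns both inclusions into equalities. -/
theorem centralizer_eq_of_coprime (h : ∀ x ∉ center G, (centralizer {x}).index = m) {x y : G}
    (hx : x ∉ center G) (hy : y ∉ center G) (hxy : Commute x y) {a b : ℕ} (hab : a.Coprime b)
    (hxa : x ^ a = 1) (hyb : y ^ b = 1) : centralizer {x} = centralizer {y} := by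
  have key : ∀ {x y : G} {a b : ℕ}, x ∉ center G → Commute x y → a.Coprime b → x ^ a = 1 →
      y ^ b = 1 → x * y ∉ center G ∧ centralizer {x * y} = centralizer {x} := by
    intro x y a b hx hxy hab hxa hyb
    have hmem : x ∈ zpowers (x * y) := by
      have h1 : (x * y) ^ b = x ^ b := by rw [hxy.mul_pow, hyb, mul_one]
      have h2 : x ∈ zpowers (x ^ b) := by
        have hco : (orderOf x).Coprime b := hab.coprime_dvd_left (orderOf_dvd_of_pow_eq_one hxa)
        obtain ⟨n, hn⟩ := exists_pow_eq_self_of_coprime hco.symm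
        exact ⟨n, by simpa using hn⟩
      exact (zpowers_le.2 (mem_zpowers_iff.2 ⟨(b : ℤ), by simpa using h1⟩) :
        zpowers (x ^ b) ≤ _) h2
    have hnot : x * y ∉ center G := fun hc => hx ((zpowers_le.2 hc : _ ≤ center G) hmem)
    exact ⟨hnot, centralizer_eq_of_mem_zpowers h hnot hx hmem⟩
  rw [← (key hx hxy hab hxa hyb).2, hxy.eq, (key hy hxy.symm hab.symm hyb hxa).2]

theorem exists_primary_of_notMem_center (h : ∀ x ∉ center G, (centralizer {x}).index = m) {x : G}
    (hx : x ∉ center G) :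
    ∃ p y, p.Prime ∧ y ∉ center G ∧ (∃ k, y ^ p ^ k = 1) ∧ y ∈ zpowers x ∧
      centralizer {y} = centralizer {x} := by
  have hne : (center G).relIndex (zpowers x) ≠ 1 := fun h1 =>
    hx (relIndex_eq_one.1 h1 (mem_zpowers x))
  obtain ⟨p, hp, hdvd⟩ := Nat.exists_prime_and_dvd hne
  obtain ⟨y, hy, hyZ, hk⟩ := exists_pow_eq_one_of_dvd_relIndex hp hdvd
  exact ⟨p, y, hp, hyZ, hk, hy, (centralizer_eq_of_mem_zpowers h hx hyZ hy).symm⟩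

end EqualClasses

/-! ### Two primes dividing the index of the center -/

section EqualClasses

variable {G : Type*} [Group G] [Finite G] {m : ℕ}

/-- The index `|C(x) : Z|` is the same for all noncentral `x`, so `x` may be replaced by a
noncentral `r`-element, whose own image in its centralizer modulo `Z` has order divisible by `r`. -/
theorem dvd_relIndex_centralizer (h : ∀ x ∉ center G, (centralizer {x}).index = m) {r : ℕ}
    (hr : r.Prime) (hdvd : r ∣ (center G).index) {x : G} (hx : x ∉ center G) :
    r ∣ (center G).relIndex (centralizer {x}) := by
  obtain ⟨y, hy, k, hk⟩ := exists_pow_eq_one_of_dvd_index hr hdvd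
  have hm : 0 < m := by
    rw [← h x hx]
    exact Nat.pos_of_ne_zero FiniteIndex.index_ne_zero
  have hxy : (center G).relIndex (centralizer {x}) = (center G).relIndex (centralizer {y}) :=
    Nat.eq_of_mul_eq_mul_right hm
      ((relIndex_centralizer_mul h hx).trans (relIndex_centralizer_mul h hy).symm)
  have hmem : (y : G ⧸ center G) ∈ (centralizer {y}).map (QuotientGroup.mk' (center G)) :=
    ⟨y, mem_centralizer_singleton_iff.2 rfl, rfl⟩
  rw [hxy, ← card_map_mk_center]
  refine dvd_trans ?_ (orderOf_dvd_natCard _ hmem)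
  have h1 : orderOf (y : G ⧸ center G) ∣ r ^ k := by
    rw [orderOf_dvd_iff_pow_eq_one, ← QuotientGroup.mk_pow, hk, QuotientGroup.mk_one]
  obtain ⟨j, -, hj⟩ := (Nat.dvd_prime_pow hr).1 h1
  rw [hj]
  refine dvd_pow_self r ?_
  rintro rfl
  rw [pow_zero, orderOf_eq_one_iff, QuotientGroup.eq_one_iff] at hj
  exact hy hj

/-- If all noncentral classes have equal size and `G/Z(G)` is not a `p`-group, then distinct
centralizers of noncentral elements meet in the center. -/
theorem centralizer_eq_of_mem_centralizer (h : ∀ x ∉ center G, (centralizer {x}).index = m)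
    (hpq : ∀ p : ℕ, ∃ q : ℕ, q.Prime ∧ q ≠ p ∧ q ∣ (center G).index) {x a : G}
    (hx : x ∉ center G) (ha : a ∉ center G) (hax : a ∈ centralizer {x}) :
    centralizer {a} = centralizer {x} := by
  obtain ⟨p, x', hp, hx', ⟨k, hk⟩, -, hxx'⟩ := exists_primary_of_notMem_center h hx
  obtain ⟨s, a', hs, ha', ⟨l, hl⟩, haa, haa'⟩ := exists_primary_of_notMem_center h ha
  -- An auxiliary `q`-element `y` with `C(y) = C(x')`: when `a'` and `x'` belong to the same prime,
  -- coprimality is available between `a'` and `y` instead.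
  obtain ⟨q, hq, hqp, hdvd⟩ := hpq p
  obtain ⟨y, hyC, hy, j, hj⟩ :=
    exists_pow_eq_one_of_dvd_relIndex hq (dvd_relIndex_centralizer h hq hdvd hx')
  have hyx : centralizer {y} = centralizer {x'} :=
    centralizer_eq_of_coprime h hy hx' (mem_centralizer_singleton_iff.1 hyC)
      (Nat.coprime_pow_primes j k hq hp hqp) hj hk
  have ha'C : a' ∈ centralizer {x'} := by
    rw [hxx']
    exact (zpowers_le.2 hax) haa
  rw [← haa', ← hxx']
  by_cases hsp : s = p
  · rw [← hyx] at ha'C ⊢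
    exact centralizer_eq_of_coprime h ha' hy (mem_centralizer_singleton_iff.1 ha'C)
      (Nat.coprime_pow_primes l j hs hq (hsp ▸ hqp.symm)) hl hj
  · exact centralizer_eq_of_coprime h ha' hx' (mem_centralizer_singleton_iff.1 ha'C)
      (Nat.coprime_pow_primes l k hs hp hsp) hl hk

theorem commute_of_mem_centralizer (h : ∀ x ∉ center G, (centralizer {x}).index = m)
    (hpq : ∀ p : ℕ, ∃ q : ℕ, q.Prime ∧ q ≠ p ∧ q ∣ (center G).index) {x a b : G}
    (hx : x ∉ center G) (ha : a ∈ centralizer {x}) (hb : b ∈ centralizer {x}) : Commute a b := by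
  by_cases haZ : a ∈ center G
  · exact (mem_center_iff.1 haZ b).symm
  · rw [← centralizer_eq_of_mem_centralizer h hpq hx haZ ha] at hb
    exact (mem_centralizer_singleton_iff.1 hb).symm

/-- For `y` outside `C(x)`, the images of `C(x)` and `C(y)` in `G/Z` meet trivially. Both have order
`c`, so `c * c ≤ |G : Z| = c * m`. -/
theorem relIndex_centralizer_le (h : ∀ x ∉ center G, (centralizer {x}).index = m)
    (hpq : ∀ p : ℕ, ∃ q : ℕ, q.Prime ∧ q ≠ p ∧ q ∣ (center G).index) {x : G}
    (hx : x ∉ center G) : (center G).relIndex (centralizer {x}) ≤ m := by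
  obtain ⟨y, hy⟩ : ∃ y, y ∉ centralizer {x} := by
    by_contra! hcon
    exact hx (centralizer_singleton_eq_top_iff.1 (eq_top_iff.2 fun y _ => hcon y))
  have hyZ : y ∉ center G := fun hc => hy (center_le_centralizer _ hc)
  set π := QuotientGroup.mk' (center G)
  have hdisj : Disjoint ((centralizer {x}).map π) ((centralizer {y}).map π) := by
    rw [disjoint_def]
    rintro _ ⟨a, ha, rfl⟩ ⟨b, hb, hab⟩
    have hay : a ∈ centralizer {y} := by
      obtain ⟨z, hz, rfl⟩ : ∃ z ∈ center G, a = b * z :=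
        ⟨b⁻¹ * a, QuotientGroup.eq.1 hab, by group⟩
      exact mul_mem hb (center_le_centralizer _ hz)
    by_contra hne
    have haZ : a ∉ center G := fun hc => hne ((QuotientGroup.eq_one_iff a).2 hc)
    apply hy
    rw [← centralizer_eq_of_mem_centralizer h hpq hx haZ ha,
      centralizer_eq_of_mem_centralizer h hpq hyZ haZ hay]
    exact mem_centralizer_singleton_iff.2 rfl
  have hcard := Nat.card_le_card_of_injective _ (mul_injective_of_disjoint hdisj)
  rw [Nat.card_prod, card_map_mk_center, card_map_mk_center, ← index_eq_card] at hcard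
  have hm : 0 < m := by
    rw [← h x hx]
    exact Nat.pos_of_ne_zero FiniteIndex.index_ne_zero
  have hxm := relIndex_centralizer_mul h hx
  have hym := relIndex_centralizer_mul h hyZ
  have hxy := Nat.eq_of_mul_eq_mul_right hm (hxm.trans hym.symm)
  rw [← hxy, ← hxm] at hcard
  refine Nat.le_of_mul_le_mul_left hcard (Nat.pos_of_ne_zero ?_)
  exact left_ne_zero_of_mul (hxm ▸ FiniteIndex.index_ne_zero)

/-- The `r`-part of the common class size is bounded by the `q`-part of the order of a centralizer
modulo the center. -/
theorem ordProj_lt_ordProj_relIndex (h : ∀ x ∉ center G, (centralizer {x}).index = m)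
    (hpq : ∀ p : ℕ, ∃ q : ℕ, q.Prime ∧ q ≠ p ∧ q ∣ (center G).index) {r q : ℕ}
    (hr : r.Prime) (hq : q.Prime) (hrq : r ≠ q) (hri : r ∣ (center G).index)
    (hqi : q ∣ (center G).index) {x : G} (hx : x ∉ center G) :
    ordProj[r] m < ordProj[q] ((center G).relIndex (centralizer {x})) := by
  have := Fact.mk hr
  have := Fact.mk hq
  have hm : 0 < m := by
    rw [← h x hx]
    exact Nat.pos_of_ne_zero FiniteIndex.index_ne_zero
  set π := QuotientGroup.mk' (center G)
  have hπ1 : ∀ g : G, π g = 1 ↔ g ∈ center G := fun g => QuotientGroup.eq_one_iff g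
  let R : Sylow r G := default
  let Rb : Subgroup (G ⧸ center G) := (R : Subgroup G).map π
  have hRb : IsPGroup r Rb := R.2.map π
  -- the image of `R` is a Sylow subgroup of the quotient
  have hcardRb : Nat.card Rb = ordProj[r] (center G).index := by
    rw [index_eq_card]
    let S := R.mapSurjective (QuotientGroup.mk'_surjective (center G))
    exact S.card_eq_multiplicity
  have hRnt : Nontrivial Rb := by
    rw [← Finite.one_lt_card_iff_nontrivial, hcardRb]
    exact Nat.one_lt_pow (hr.factorization_pos_of_dvd FiniteIndex.index_ne_zero hri).ne' hr.one_lt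
  -- Since the image of `z` is central in that of `R`, conjugation by `R` changes `z` only by
  -- central factors, so `R` normalizes `C(z)`.
  have := hRb.center_nontrivial
  obtain ⟨⟨⟨_, z, hzR, rfl⟩, hzc⟩, hz1⟩ := exists_ne (1 : center Rb)
  have hz : z ∉ center G := fun hc => hz1 (by
    ext
    exact (hπ1 z).2 hc)
  have hzR' : ∀ g ∈ (R : Subgroup G), π g * π z = π z * π g := by
    intro g hg
    have := mem_center_iff.1 hzc ⟨π g, g, hg, rfl⟩
    exact congrArg Subtype.val this
  -- reduce to the centralizer of `z`
  have hxz : (center G).relIndex (centralizer {x}) = (center G).relIndex (centralizer {z}) :=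
    Nat.eq_of_mul_eq_mul_right hm
      ((relIndex_centralizer_mul h hx).trans (relIndex_centralizer_mul h hz).symm)
  rw [hxz]
  set C := centralizer {z} with hC
  obtain ⟨y, hyC, hy, j, hj⟩ :=
    exists_pow_eq_one_of_dvd_relIndex hq (dvd_relIndex_centralizer h hq hqi hz)
  have hyz : centralizer {y} = C := centralizer_eq_of_mem_centralizer h hpq hz hy hyC
  have hnorm : ∀ g ∈ (R : Subgroup G), g * y * g⁻¹ ∈ C := by
    intro g hg
    obtain ⟨w, hw, hgz⟩ : ∃ w ∈ center G, g⁻¹ * z * g = z * w := by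
      refine ⟨z⁻¹ * (g⁻¹ * z * g), (hπ1 _).1 ?_, by group⟩
      have := hzR' g hg
      rw [map_mul, map_mul, map_mul, map_inv, map_inv, mul_assoc, ← this]
      group
    have h1 : y * (z * w) = z * w * y := by
      have h2 := mem_centralizer_singleton_iff.1 hyC
      have h3 := mem_center_iff.1 hw y
      rw [← mul_assoc, h2, mul_assoc, h3, mul_assoc]
    rw [hC, mem_centralizer_singleton_iff]
    rw [← hgz] at h1
    calc g * y * g⁻¹ * z = g * (y * (g⁻¹ * z * g)) * g⁻¹ := by group
      _ = g * (g⁻¹ * z * g * y) * g⁻¹ := by rw [h1]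
      _ = z * (g * y * g⁻¹) := by group
  -- If `g` fixes `y` modulo `Z`, the central factor `w` has `r`-power order (iterate `g`) and
  -- `q`-power order (compare `y` with its conjugate `y * w`). Hence `w = 1`.
  have hfix : ∀ g ∈ (R : Subgroup G), π (g * y * g⁻¹) = π y → g ∈ C := by
    intro g hg hgy
    obtain ⟨w, hw, hgw⟩ : ∃ w ∈ center G, g * y * g⁻¹ = y * w :=
      ⟨y⁻¹ * (g * y * g⁻¹), QuotientGroup.eq.1 hgy.symm, by group⟩
    have hwc : ∀ t, Commute w t := fun t => (mem_center_iff.1 hw t).symm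
    have hiter : ∀ i : ℕ, g ^ i * y * (g ^ i)⁻¹ = y * w ^ i := by
      intro i
      induction i with
      | zero => simp
      | succ i ih =>
        calc g ^ (i + 1) * y * (g ^ (i + 1))⁻¹ = g * (g ^ i * y * (g ^ i)⁻¹) * g⁻¹ := by
              rw [pow_succ']; group
          _ = g * y * (w ^ i * g⁻¹) := by rw [ih]; group
          _ = g * y * g⁻¹ * w ^ i := by rw [((hwc g⁻¹).pow_left i).eq]; group
          _ = y * w ^ (i + 1) := by rw [hgw, pow_succ']; group
    obtain ⟨k, hk⟩ := R.2 ⟨g, hg⟩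
    have hgk : g ^ r ^ k = 1 := by simpa using congrArg (fun t : R => (t : G)) hk
    have hwr : w ^ r ^ k = 1 := by
      have := hiter (r ^ k)
      rw [hgk] at this
      simpa using this
    have hwq : w ^ q ^ j = 1 := by
      have h1 : (y * w) ^ q ^ j = 1 := by rw [← hgw, conj_pow, hj]; group
      rwa [(hwc y).symm.mul_pow, hj, one_mul] at h1
    have hw1 : w = 1 := by
      rw [← orderOf_eq_one_iff]
      exact Nat.eq_one_of_dvd_coprimes (Nat.coprime_pow_primes k j hr hq hrq)
        (orderOf_dvd_of_pow_eq_one hwr) (orderOf_dvd_of_pow_eq_one hwq)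
    rw [← hyz, mem_centralizer_singleton_iff]
    rw [hw1, mul_one, mul_inv_eq_iff_eq_mul] at hgw
    exact hgw
  -- Sylow `q`-subgroup of the image of `C`
  let Cb := C.map π
  have hCbcomm : ∀ a b : Cb, a * b = b * a := by
    rintro ⟨_, a, ha, rfl⟩ ⟨_, b, hb, rfl⟩
    ext
    exact ((commute_of_mem_centralizer h hpq hz ha hb).map π).eq
  let Q : Sylow q Cb := default
  have hcardQ : Nat.card Q = ordProj[q] ((center G).relIndex C) := by
    rw [← card_map_mk_center]
    exact Q.card_eq_multiplicity
  have hmemQ : ∀ t : Cb, t ^ q ^ j = 1 → t ∈ Q := by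
    intro t ht
    have hnormal : (zpowers t).Normal := ⟨fun n hn g => by
      rwa [hCbcomm g n, mul_inv_cancel_right]⟩
    have hp : IsPGroup q (zpowers t) := by
      refine IsPGroup.of_card_dvd_pow (n := j) ?_
      rw [Nat.card_zpowers]
      exact orderOf_dvd_of_pow_eq_one ht
    exact hp.le_sylow_of_normal Q (mem_zpowers t)
  -- the orbit of `y` under `R`
  let conj : ↥(R : Subgroup G) → Q := fun g =>
    ⟨⟨π ((g : G) * y * (g : G)⁻¹), (g : G) * y * (g : G)⁻¹, hnorm g g.2, rfl⟩, hmemQ _ (by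
      ext
      simp only [SubmonoidClass.coe_pow, OneMemClass.coe_one]
      rw [← map_pow, conj_pow, hj, mul_one, mul_inv_cancel, map_one])⟩
  have hconj : ∀ a b : (R : Subgroup G), conj a = conj b → a⁻¹ * b ∈ C.subgroupOf R := by
    intro a b hab
    have h1 : π ((a : G) * y * (a : G)⁻¹) = π ((b : G) * y * (b : G)⁻¹) :=
      congrArg (fun t : Q => ((t : Cb) : G ⧸ center G)) hab
    refine hfix _ (a⁻¹ * b).2 ?_
    calc π ((a⁻¹ * b : (R : Subgroup G)) * y * (a⁻¹ * b : (R : Subgroup G))⁻¹)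
        = π (a : G)⁻¹ * π ((b : G) * y * (b : G)⁻¹) * π (a : G) := by simp only [← map_mul]; simp [mul_assoc]
      _ = π y := by rw [← h1]; simp only [← map_mul]; simp [mul_assoc]
  have hconj1 : ∀ a : (R : Subgroup G), conj a ≠ 1 := by
    intro a ha
    have h1 : π ((a : G) * y * (a : G)⁻¹) = 1 := congrArg (fun t : Q => ((t : Cb) : G ⧸ center G)) ha
    apply hy
    rw [← hπ1]
    rw [map_mul, map_mul, map_inv π] at h1
    exact conj_eq_one_iff.1 h1
  -- Cosets of `R ∩ C` inject into `Q` via conjugates of `y`. The identity is missed because `y` is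
  -- noncentral, whence the strict inequality.
  have hcount : C.relIndex R < Nat.card Q := by
    let f : (R : Subgroup G) ⧸ C.subgroupOf R → Q := fun t => conj t.out
    have hf : Function.Injective f := fun s t hst => by
      rw [← QuotientGroup.out_eq' s, ← QuotientGroup.out_eq' t]
      exact QuotientGroup.eq.2 (hconj _ _ hst)
    have hfin : Fintype ((R : Subgroup G) ⧸ C.subgroupOf R) := Fintype.ofFinite _
    have hfin' : Fintype Q := Fintype.ofFinite _
    rw [relIndex, index_eq_card, Nat.card_eq_fintype_card, Nat.card_eq_fintype_card]
    exact Fintype.card_lt_of_injective_of_notMem f hf (b := 1) fun ⟨t, ht⟩ => hconj1 _ ht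
  rw [← hcardQ]
  refine lt_of_le_of_lt ?_ hcount
  -- Since `|R| = |C|_r * m_r` and `|R ∩ C| ≤ |C|_r`, the index `|R : R ∩ C|` is at least `m_r`.
  have hcardR : Nat.card (R : Subgroup G) = ordProj[r] (Nat.card C) * ordProj[r] m := by
    rw [← Nat.ordProj_mul r Nat.card_pos.ne' hm.ne', ← h z hz, card_mul_index]
    exact R.card_eq_multiplicity
  have hinter : Nat.card (C.subgroupOf R) ≤ ordProj[r] (Nat.card C) := by
    have hdC : Nat.card (C.subgroupOf R) ∣ Nat.card C := by
      rw [Nat.card_congr ((C.subgroupOf R).equivMapOfInjective _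
        (R : Subgroup G).subtype_injective).toEquiv]
      exact card_dvd_of_le (map_le_iff_le_comap.2 le_rfl)
    obtain ⟨k, hk⟩ := (R.2.to_subgroup (C.subgroupOf R)).exists_card_eq
    rw [hk] at hdC ⊢
    exact Nat.pow_le_pow_right hr.pos ((hr.pow_dvd_iff_le_factorization Nat.card_pos.ne').1 hdC)
  have hmul := card_mul_index (C.subgroupOf R)
  rw [hcardR] at hmul
  refine le_of_mul_le_mul_left (a := ordProj[r] (Nat.card C)) ?_ (pow_pos hr.pos _)
  rw [← hmul]
  exact Nat.mul_le_mul_right _ hinter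

end EqualClasses

/-- Take `a` with the smallest primary part of `c`. For `p ≠ a` the `p`-part of `m` is below the
`a`-part of `c`, hence below the `p`-part of `c`. The prime `a` is handled by pairing it with a
second prime `b` and comparing crosswise. -/
theorem lt_of_ordProj_lt_ordProj {c m : ℕ} (hc : c ≠ 0) (hm : m ≠ 0)
    (hsub : m.primeFactors ⊆ c.primeFactors) (hnt : c.primeFactors.Nontrivial)
    (h : ∀ r ∈ c.primeFactors, ∀ q ∈ c.primeFactors, r ≠ q → ordProj[r] m < ordProj[q] c) :
    m < c := by
  have key : ∀ n : ℕ, n ≠ 0 → n.primeFactors ⊆ c.primeFactors →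
      n = ∏ p ∈ c.primeFactors, ordProj[p] n := by
    intro n hn hs
    conv_lhs => rw [← Nat.prod_factorization_pow_eq_self hn]
    exact Finsupp.prod_of_support_subset _ hs _ fun _ _ => pow_zero _
  obtain ⟨a, ha, hmin⟩ := Finset.exists_min_image c.primeFactors (fun p => ordProj[p] c)
    hnt.nonempty
  obtain ⟨b, hb, hba⟩ := hnt.exists_ne a
  have hb' : b ∈ c.primeFactors.erase a := Finset.mem_erase.2 ⟨hba, hb⟩
  have split : ∀ f : ℕ → ℕ, ∏ p ∈ c.primeFactors, f p =
      f a * f b * ∏ p ∈ (c.primeFactors.erase a).erase b, f p := by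
    intro f
    rw [mul_assoc, Finset.mul_prod_erase _ f hb', Finset.mul_prod_erase _ f ha]
  calc m = ordProj[a] m * ordProj[b] m *
        ∏ p ∈ (c.primeFactors.erase a).erase b, ordProj[p] m := (key m hm hsub).trans (split _)
    _ < ordProj[a] c * ordProj[b] c *
        ∏ p ∈ (c.primeFactors.erase a).erase b, ordProj[p] c := ?_
    _ = c := ((key c hc subset_rfl).trans (split _)).symm
  refine Nat.mul_lt_mul_of_lt_of_le ?_ (Finset.prod_le_prod' fun p hp => ?_)
    (Finset.prod_pos fun p hp => ?_)
  · rw [mul_comm (ordProj[a] c)]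
    exact Nat.mul_lt_mul'' (h a ha b hb hba.symm) (h b hb a ha hba)
  · simp only [Finset.mem_erase] at hp
    exact (h p hp.2.2 a ha hp.2.1).le.trans (hmin p hp.2.2)
  · simp only [Finset.mem_erase] at hp
    exact Nat.ordProj_pos _ _

/-- **Itô's theorem** on finite groups with two class sizes: the central quotient is a group of
prime power order. -/
theorem isPGroup_quotient_center {G : Type*} [Group G] [Finite G] {m : ℕ}
    (h : ∀ x ∉ center G, (centralizer {x}).index = m) (hG : center G ≠ ⊤) :
    ∃ p : ℕ, p.Prime ∧ IsPGroup p (G ⧸ center G) := by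
  have hi : (center G).index ≠ 0 := FiniteIndex.index_ne_zero
  by_cases hpq : ∀ p : ℕ, ∃ q : ℕ, q.Prime ∧ q ≠ p ∧ q ∣ (center G).index
  · exfalso
    obtain ⟨x, hx⟩ : ∃ x, x ∉ center G := by
      by_contra! hcon
      exact hG (eq_top_iff.2 fun x _ => hcon x)
    have hcm := relIndex_centralizer_mul h hx
    have hc : (center G).relIndex (centralizer {x}) ≠ 0 := left_ne_zero_of_mul (hcm ▸ hi)
    have hm : m ≠ 0 := right_ne_zero_of_mul (hcm ▸ hi)
    have hmem : ∀ q : ℕ, q.Prime → q ∣ (center G).index →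
        q ∈ ((center G).relIndex (centralizer {x})).primeFactors := fun q hq hqi =>
      Nat.mem_primeFactors.2 ⟨hq, dvd_relIndex_centralizer h hq hqi hx, hc⟩
    have hdvd : ∀ q ∈ ((center G).relIndex (centralizer {x})).primeFactors,
        q.Prime ∧ q ∣ (center G).index := fun q hq =>
      ⟨Nat.prime_of_mem_primeFactors hq, (Nat.dvd_of_mem_primeFactors hq).trans (Dvd.intro _ hcm)⟩
    refine (relIndex_centralizer_le h hpq hx).not_gt
      (lt_of_ordProj_lt_ordProj hc hm ?_ ?_ fun r hr q hq hrq => ?_)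
    · intro q hq
      exact hmem q (Nat.prime_of_mem_primeFactors hq)
        ((Nat.dvd_of_mem_primeFactors hq).trans (Dvd.intro_left _ hcm))
    · obtain ⟨p, hp, -, hpi⟩ := hpq 0
      obtain ⟨q, hq, hqp, hqi⟩ := hpq p
      exact ⟨p, hmem p hp hpi, q, hmem q hq hqi, hqp.symm⟩
    · exact ordProj_lt_ordProj_relIndex h hpq (hdvd r hr).1 (hdvd q hq).1 hrq (hdvd r hr).2
        (hdvd q hq).2 hx
  · push Not at hpq
    obtain ⟨p, hp⟩ := hpq
    have hi1 : (center G).index ≠ 1 := fun h1 => hG (index_eq_one.1 h1)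
    obtain ⟨q, hq, hqi⟩ := Nat.exists_prime_and_dvd hi1
    have hqp : q = p := by
      by_contra hne
      exact hp q hq hne hqi
    subst hqp
    refine ⟨q, hq, IsPGroup.of_card_dvd_pow (n := (center G).index.primeFactorsList.length) ?_⟩
    rw [← index_eq_card]
    refine (Nat.eq_prime_pow_of_unique_prime_dvd hi fun {d} hd hdi => ?_).dvd
    by_contra hne
    exact hp d hd hne hdi

/-! ### Isoclinism and passage to a Sylow subgroup -/

/-- A criterion for isoclinism: `H` maps onto `G/Z(G)` with kernel `Z(H)`, and `γ₂(G)` embeds in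
`H` with image `γ₂(H)`, compatibly with commutators. -/
theorem IsIsoclinic.of_hom {G H : Type*} [Group G] [Group H] (π : H →* G ⧸ center G)
    (ι : commutator G →* H) (hπ : Function.Surjective π) (hker : π.ker = center H)
    (hι : Function.Injective ι) (hrange : ι.range = commutator H)
    (hcomm : ∀ h k : H, ι (commutatorMap G (π h) (π k)) = ⁅h, k⁆) : IsIsoclinic G H := by
  let e : H ⧸ center H ≃* G ⧸ center G :=
    (QuotientGroup.quotientMulEquivOfEq hker.symm).trans
      (QuotientGroup.quotientKerEquivOfSurjective π hπ)
  have he : ∀ h : H, e (h : H ⧸ center H) = π h := fun _ => rfl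
  refine ⟨e.symm, (MonoidHom.ofInjective hι).trans (MulEquiv.subgroupCongr hrange), ?_⟩
  intro x y
  obtain ⟨h, rfl⟩ := hπ x
  obtain ⟨k, rfl⟩ := hπ y
  rw [← he h, ← he k, MulEquiv.symm_apply_apply, MulEquiv.symm_apply_apply, he, he]
  ext
  rw [commutatorMap_mk]
  exact hcomm h k

/-- A subgroup that together with the center generates the group is isoclinic to the group. -/
theorem isIsoclinic_of_sup_center {G : Type*} [Group G] {P : Subgroup G}
    (hP : ∀ g : G, ∃ a ∈ P, ∃ z ∈ center G, g = a * z) : IsIsoclinic G P := by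
  have hcomm : ∀ g h : G, ∃ a b : P, ⁅g, h⁆ = ⁅(a : G), (b : G)⁆ := by
    intro g h
    obtain ⟨a, ha, z, hz, rfl⟩ := hP g
    obtain ⟨b, hb, w, hw, rfl⟩ := hP h
    refine ⟨⟨a, ha⟩, ⟨b, hb⟩, ?_⟩
    rw [← commutatorMap_mk, ← commutatorMap_mk]
    congr 2
    · exact QuotientGroup.mk_mul_of_mem a hz
    · exact QuotientGroup.mk_mul_of_mem b hw
  have hmap : (commutator P).map P.subtype = commutator G := by
    refine le_antisymm ?_ ?_
    · rw [commutator_def, commutator_def, map_commutator]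
      exact commutator_mono le_top le_top
    · rw [commutator_def, commutator_le]
      rintro g - h -
      obtain ⟨a, b, hab⟩ := hcomm g h
      rw [hab]
      exact ⟨⁅a, b⁆, commutator_mem_commutator (mem_top _) (mem_top _), rfl⟩
  have hle : commutator G ≤ P := by
    rw [← hmap]
    exact map_subtype_le _
  refine IsIsoclinic.of_hom ((QuotientGroup.mk' (center G)).comp P.subtype) (inclusion hle)
    ?_ ?_ (inclusion_injective hle) ?_ fun h k => rfl
  · intro x
    obtain ⟨g, rfl⟩ := QuotientGroup.mk_surjective x
    obtain ⟨a, ha, z, hz, rfl⟩ := hP g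
    exact ⟨⟨a, ha⟩, (QuotientGroup.mk_mul_of_mem a hz).symm⟩
  · ext a
    rw [MonoidHom.mem_ker, mem_center_iff]
    refine (QuotientGroup.eq_one_iff (a : G)).trans (mem_center_iff.trans ⟨fun h b => ?_, fun h g => ?_⟩)
    · exact Subtype.ext (h b)
    · obtain ⟨b, hb, z, hz, rfl⟩ := hP g
      have h1 : b * a = a * b := congrArg Subtype.val (h ⟨b, hb⟩)
      have h2 := mem_center_iff.1 hz a
      rw [mul_assoc, ← h2, ← mul_assoc, h1, mul_assoc]
  · rw [inclusion_range]
    ext a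
    rw [mem_subgroupOf, ← hmap]
    exact mem_map_iff_mem P.subtype_injective

theorem mem_conjugatesOf_iff {G : Type*} [Group G] {x y : G} :
    y ∈ conjugatesOf x ↔ ∃ c, c * x * c⁻¹ = y :=
  isConj_iff

theorem conjugatesOf_coe_subgroup {G : Type*} [Group G] {P : Subgroup G}
    (hP : ∀ g : G, ∃ a ∈ P, ∃ z ∈ center G, g = a * z) (x : P) :
    conjugatesOf (x : G) = Subtype.val '' conjugatesOf x := by
  ext y
  simp only [mem_conjugatesOf_iff, Set.mem_image]
  constructor
  · rintro ⟨g, rfl⟩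
    obtain ⟨a, ha, z, hz, rfl⟩ := hP g
    refine ⟨⟨a, ha⟩ * x * ⟨a, ha⟩⁻¹, ⟨⟨a, ha⟩, rfl⟩, ?_⟩
    have h : z * x * z⁻¹ = x := by rw [← mem_center_iff.1 hz x, mul_inv_cancel_right]
    calc a * x * a⁻¹ = a * (z * x * z⁻¹) * a⁻¹ := by rw [h]
      _ = a * z * x * (a * z)⁻¹ := by group
  · rintro ⟨_, ⟨a, rfl⟩, rfl⟩
    exact ⟨a, rfl⟩

/-- Central factors act trivially by conjugation and only translate classes, so each class of `G` is
a central translate of a class of `P`. -/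
theorem conjClassSizes_subgroup {G : Type*} [Group G] {P : Subgroup G}
    (hP : ∀ g : G, ∃ a ∈ P, ∃ z ∈ center G, g = a * z) :
    conjClassSizes P = conjClassSizes G := by
  ext n
  constructor
  · rintro ⟨x, rfl⟩
    refine ⟨x, ?_⟩
    simp only [conjugatesOf_coe_subgroup hP x]
    exact Set.ncard_image_of_injective _ Subtype.val_injective
  · rintro ⟨g, rfl⟩
    obtain ⟨a, ha, z, hz, rfl⟩ := hP g
    refine ⟨⟨a, ha⟩, ?_⟩
    have h : conjugatesOf (a * z) = (fun t => t * z) '' conjugatesOf a := by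
      have hc : ∀ c : G, c * (a * z) * c⁻¹ = c * a * c⁻¹ * z := fun c => by
        have := mem_center_iff.1 hz c⁻¹
        simp only [mul_assoc, this]
      ext y
      simp only [mem_conjugatesOf_iff, Set.mem_image]
      constructor
      · rintro ⟨c, rfl⟩
        exact ⟨_, ⟨c, rfl⟩, (hc c).symm⟩
      · rintro ⟨_, ⟨c, rfl⟩, rfl⟩
        exact ⟨c, hc c⟩
    simp only [h]
    rw [Set.ncard_image_of_injective _ (mul_left_injective z),
      conjugatesOf_coe_subgroup hP ⟨a, ha⟩]
    exact (Set.ncard_image_of_injective _ Subtype.val_injective).symm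

theorem conjClassSizes_eq_of_index_centralizer {G : Type*} [Group G] [Finite G] {m : ℕ}
    (h : ∀ x ∉ center G, (centralizer {x}).index = m) (hG : center G ≠ ⊤) :
    conjClassSizes G = {1, m} := by
  have h1 : ∀ x ∈ center G, (conjugatesOf x).ncard = 1 := fun x hx => by
    rw [ncard_conjugatesOf, centralizer_singleton_eq_top_iff.2 hx, index_top]
  ext n
  constructor
  · rintro ⟨x, rfl⟩
    by_cases hx : x ∈ center G
    · exact Or.inl (h1 x hx)
    · exact Or.inr ((ncard_conjugatesOf x).trans (h x hx))
  · rintro (rfl | rfl)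
    · exact ⟨1, h1 1 (one_mem _)⟩
    · obtain ⟨x, hx⟩ : ∃ x, x ∉ center G := by
        by_contra! hcon
        exact hG (eq_top_iff.2 fun x _ => hcon x)
      exact ⟨x, (ncard_conjugatesOf x).trans (h x hx)⟩

/-- The index of `P Z` divides both `|G : Z|`, a power of `p`, and `|G : P|`, which is prime to `p`.
-/
theorem Sylow.exists_mul_center {G : Type*} [Group G] [Finite G] {p : ℕ} [Fact p.Prime]
    (hp : IsPGroup p (G ⧸ center G)) (P : Sylow p G) (g : G) :
    ∃ a ∈ (P : Subgroup G), ∃ z ∈ center G, g = a * z := by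
  have htop : (P : Subgroup G) ⊔ center G = ⊤ := by
    rw [← index_eq_one]
    obtain ⟨k, hk⟩ := hp.exists_card_eq
    refine Nat.eq_one_of_dvd_coprimes (a := p ^ k) (b := (P : Subgroup G).index) ?_ ?_ ?_
    · exact Nat.Coprime.pow_left k
        (((Fact.out : p.Prime).coprime_iff_not_dvd).2 P.not_dvd_index)
    · rw [← hk, ← index_eq_card]
      exact index_dvd_of_le le_sup_right
    · exact index_dvd_of_le le_sup_left
  have hg : g ∈ (P : Subgroup G) ⊔ center G := htop ▸ mem_top g
  obtain ⟨a, ha, z, hz, rfl⟩ := mem_sup_of_normal_right.1 hg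
  exact ⟨a, ha, z, hz, rfl⟩

theorem eq_prime_pow_of_isPGroup_quotient_center {G : Type*} [Group G] [Finite G] {m p : ℕ}
    [Fact p.Prime] (h : ∀ x ∉ center G, (centralizer {x}).index = m) (hG : center G ≠ ⊤)
    (hp : IsPGroup p (G ⧸ center G)) : ∃ r, 0 < r ∧ m = p ^ r := by
  obtain ⟨x, hx⟩ : ∃ x, x ∉ center G := by
    by_contra! hcon
    exact hG (eq_top_iff.2 fun x _ => hcon x)
  obtain ⟨k, hk⟩ := hp.exists_card_eq
  have hdvd : m ∣ p ^ k := by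
    rw [← hk, ← index_eq_card, ← relIndex_centralizer_mul h hx]
    exact dvd_mul_left _ _
  obtain ⟨r, -, rfl⟩ := (Nat.dvd_prime_pow Fact.out).1 hdvd
  refine ⟨r, Nat.pos_of_ne_zero ?_, rfl⟩
  rintro rfl
  exact hx (centralizer_singleton_eq_top_iff.1 (index_eq_one.1 (by rw [h x hx, pow_zero])))

/-! ### Central extensions by bilinear cocycles -/

/-- The central extension of `V` by `W` defined by the bilinear cocycle `f`. -/
@[ext]
structure BilinExt {V W : Type*} [AddCommGroup V] [AddCommGroup W] (f : V →+ V →+ W) where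
  fst : V
  snd : W

namespace BilinExt

variable {V W : Type*} [AddCommGroup V] [AddCommGroup W] {f : V →+ V →+ W}

instance : Mul (BilinExt f) := ⟨fun a b => ⟨a.fst + b.fst, a.snd + b.snd + f a.fst b.fst⟩⟩
instance : One (BilinExt f) := ⟨⟨0, 0⟩⟩
-- The term `f a.fst a.fst` cancels `f (-a.fst) a.fst`, which arises in `a⁻¹ * a`.
instance : Inv (BilinExt f) := ⟨fun a => ⟨-a.fst, -a.snd + f a.fst a.fst⟩⟩

@[simp] theorem fst_mul (a b : BilinExt f) : (a * b).fst = a.fst + b.fst := rfl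
@[simp] theorem snd_mul (a b : BilinExt f) : (a * b).snd = a.snd + b.snd + f a.fst b.fst := rfl
@[simp] theorem fst_one : (1 : BilinExt f).fst = 0 := rfl
@[simp] theorem snd_one : (1 : BilinExt f).snd = 0 := rfl
@[simp] theorem fst_inv (a : BilinExt f) : a⁻¹.fst = -a.fst := rfl
@[simp] theorem snd_inv (a : BilinExt f) : a⁻¹.snd = -a.snd + f a.fst a.fst := rfl

instance : Group (BilinExt f) :=
  Group.ofLeftAxioms
    (fun a b c => by
      ext
      · simp [add_assoc]
      · simp only [snd_mul, fst_mul, map_add, AddMonoidHom.add_apply]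
        abel)
    (fun a => by ext <;> simp)
    (fun a => by ext <;> simp)

/-- The projection onto `V`. -/
def proj (f : V →+ V →+ W) : BilinExt f →* Multiplicative V where
  toFun a := Multiplicative.ofAdd a.fst
  map_one' := rfl
  map_mul' _ _ := rfl

/-- The inclusion of `W`. -/
def incl (f : V →+ V →+ W) : Multiplicative W →* BilinExt f where
  toFun w := ⟨0, w.toAdd⟩
  map_one' := rfl
  map_mul' v w := by ext <;> simp

theorem commutatorElement_eq (a b : BilinExt f) :
    ⁅a, b⁆ = ⟨0, f a.fst b.fst - f b.fst a.fst⟩ := by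
  rw [commutatorElement_def, mul_inv_eq_iff_eq_mul, mul_inv_eq_iff_eq_mul]
  ext
  · simp [add_comm]
  · simp only [snd_mul, fst_mul, zero_add, map_zero, AddMonoidHom.zero_apply]
    abel

/-- `BilinExt f` as a set of pairs. -/
def equivProd (f : V →+ V →+ W) : BilinExt f ≃ V × W where
  toFun a := (a.fst, a.snd)
  invFun a := ⟨a.1, a.2⟩
  left_inv _ := rfl
  right_inv _ := rfl

instance [Finite V] [Finite W] : Finite (BilinExt f) := Finite.of_equiv _ (equivProd f).symm

-- The Camina condition in bilinear form: bracketing with any nonzero `v` is onto `W`. For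
-- nontrivial `W` it also gives nondegeneracy, and so determines the center.
variable (hf : ∀ v ≠ 0, ∀ w, ∃ u, f v u - f u v = w)
include hf

theorem mem_center_iff_fst_eq_zero [Nontrivial W] {a : BilinExt f} :
    a ∈ center (BilinExt f) ↔ a.fst = 0 := by
  rw [mem_center_iff]
  constructor
  · intro h
    by_contra ha
    obtain ⟨w, hw⟩ := exists_ne (0 : W)
    obtain ⟨u, hu⟩ := hf _ ha w
    have h1 : ⁅a, (⟨u, 0⟩ : BilinExt f)⁆ = 1 := commutatorElement_eq_one_iff_mul_comm.2 (h _).symm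
    rw [commutatorElement_eq] at h1
    exact hw (hu.symm.trans (congrArg snd h1))
  · intro ha g
    rw [eq_comm, ← commutatorElement_eq_one_iff_mul_comm, commutatorElement_eq, ha]
    ext <;> simp

theorem mem_commutator_iff_fst_eq_zero [Nontrivial V] {a : BilinExt f} :
    a ∈ commutator (BilinExt f) ↔ a.fst = 0 := by
  constructor
  · intro h
    have h1 : commutator (BilinExt f) ≤ (proj f).ker := by
      rw [commutator_def, commutator_le]
      intro a _ b _
      rw [MonoidHom.mem_ker, commutatorElement_eq]
      rfl
    exact h1 h
  · intro ha
    obtain ⟨v, hv⟩ := exists_ne (0 : V)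
    obtain ⟨u, hu⟩ := hf v hv a.snd
    have h1 : ⁅(⟨v, 0⟩ : BilinExt f), ⟨u, 0⟩⁆ = a := by
      rw [commutatorElement_eq]
      ext
      · exact ha.symm
      · exact hu
    rw [← h1]
    exact commutator_mem_commutator (mem_top _) (mem_top _)

theorem center_eq_commutator [Nontrivial V] [Nontrivial W] :
    center (BilinExt f) = commutator (BilinExt f) := by
  ext a
  rw [mem_center_iff_fst_eq_zero hf, mem_commutator_iff_fst_eq_zero hf]

theorem isCamina [Nontrivial V] : IsCamina (BilinExt f) := by
  intro x hx
  rw [mem_commutator_iff_fst_eq_zero hf] at hx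
  have hconj : ∀ c : BilinExt f, c * x * c⁻¹ = x * ⟨0, f c.fst x.fst - f x.fst c.fst⟩ := by
    intro c
    have h : c * x * c⁻¹ = ⁅c, x⁆ * x := by rw [commutatorElement_def]; group
    rw [h, commutatorElement_eq]
    ext
    · simp
    · simp [add_comm]
  ext y
  simp only [mem_conjugatesOf_iff, Set.mem_image, SetLike.mem_coe,
    mem_commutator_iff_fst_eq_zero hf]
  constructor
  · rintro ⟨c, rfl⟩
    exact ⟨_, rfl, (hconj c).symm⟩
  · rintro ⟨⟨v, w⟩, rfl : v = 0, rfl⟩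
    -- The sign appears because `hconj` has the two arguments in the order opposite to `hf`.
    obtain ⟨u, hu⟩ := hf _ hx (-w)
    refine ⟨⟨u, 0⟩, (hconj _).trans ?_⟩
    rw [← neg_sub, hu, neg_neg]

omit hf in
theorem isPGroup {p : ℕ} (hV : ∀ v : V, p • v = 0) (hW : ∀ w : W, p • w = 0) :
    IsPGroup p (BilinExt f) := by
  intro a
  -- The `p`-th power of any element lies in the copy of `W`, which is killed by `p`.
  refine ⟨2, ?_⟩
  have h1 : (a ^ p).fst = 0 := by
    have := map_pow (proj f) a p
    exact (congrArg Multiplicative.toAdd this).trans (hV a.fst)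
  have h2 : a ^ p = incl f (Multiplicative.ofAdd (a ^ p).snd) := by
    ext
    · exact h1
    · rfl
  rw [pow_two, pow_mul, h2, ← map_pow]
  have h3 : Multiplicative.ofAdd (a ^ p).snd ^ p = 1 := hW _
  rw [h3, map_one]

/-- A maximal subgroup `M` either contains the center, which equals `γ₂`, or satisfies `M Z = G`;
then all commutators come from `M`. Conversely, a nonzero `V`-coordinate is detected by a functional
to `ZMod p`, whose kernel pulls back to a maximal subgroup. -/
theorem commutator_eq_frattini [Nontrivial V] [Nontrivial W] {p : ℕ} [Fact p.Prime]
    (hV : ∀ v : V, p • v = 0) : commutator (BilinExt f) = frattini (BilinExt f) := by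
  have : Module (ZMod p) V := AddCommGroup.zmodModule hV
  refine le_antisymm ?_ fun a ha => ?_
  · refine le_iInf₂ fun M hM => ?_
    by_contra hle
    refine hle ?_
    have hsup : M ⊔ center (BilinExt f) = ⊤ := by
      refine hM.2 _ (lt_of_le_of_ne le_sup_left fun h => hle ?_)
      rw [← center_eq_commutator hf, h]
      exact le_sup_right
    rw [commutator_def, commutator_le]
    intro a _ b _
    obtain ⟨a', ha', z, hz, rfl⟩ := mem_sup_of_normal_right.1 (hsup ▸ mem_top a)
    obtain ⟨b', hb', w, hw, rfl⟩ := mem_sup_of_normal_right.1 (hsup ▸ mem_top b)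
    rw [mem_center_iff_fst_eq_zero hf] at hz hw
    have h1 : ⁅a' * z, b' * w⁆ = ⁅a', b'⁆ := by
      rw [commutatorElement_eq, commutatorElement_eq]
      simp [hz, hw]
    rw [h1, commutatorElement_def]
    exact mul_mem (mul_mem (mul_mem ha' hb') (inv_mem ha')) (inv_mem hb')
  · rw [mem_commutator_iff_fst_eq_zero hf]
    by_contra hne
    obtain ⟨φ, hφ⟩ : ∃ φ : V →ₗ[ZMod p] ZMod p, φ a.fst ≠ 0 := by
      by_contra! hcon
      exact hne ((Module.forall_dual_apply_eq_zero_iff (ZMod p) a.fst).1 hcon)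
    let χ : BilinExt f →* Multiplicative (ZMod p) := φ.toAddMonoidHom.toMultiplicative.comp (proj f)
    have hχ : ∀ b, b ∈ χ.ker ↔ φ b.fst = 0 := fun b => Iff.rfl
    have hco : IsCoatom χ.ker := by
      refine ⟨fun h => hφ ((hχ a).1 (h ▸ mem_top a)), fun K hK => ?_⟩
      obtain ⟨k, hkK, hk⟩ := SetLike.exists_of_lt hK
      rw [hχ] at hk
      rw [eq_top_iff]
      intro b _
      -- Any `k` outside the kernel has a power matching `b` under `φ`, so the kernel and `k`
      -- generate the whole group.
      let n : ℕ := (φ b.fst / φ k.fst).val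
      have hn : φ (k ^ n).fst = φ b.fst := by
        have h1 : (k ^ n).fst = n • k.fst := congrArg Multiplicative.toAdd (map_pow (proj f) k n)
        rw [h1, map_nsmul, nsmul_eq_mul, ZMod.natCast_zmod_val, div_mul_cancel₀ _ hk]
      have h2 : b * (k ^ n)⁻¹ ∈ χ.ker := by
        rw [hχ, fst_mul, fst_inv, map_add, map_neg, hn, add_neg_cancel]
      have := mul_mem (hK.le h2) (pow_mem hkK n)
      rwa [inv_mul_cancel_right] at this
    exact hφ ((hχ a).1 (frattini_le_coatom hco ha))

theorem isIsoclinic [Nontrivial V] [Nontrivial W] {G : Type*} [Group G]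
    (e : Multiplicative V ≃* G ⧸ center G) (d : commutator G ≃* Multiplicative W)
    (hed : ∀ u v : V, (d (commutatorMap G (e (.ofAdd u)) (e (.ofAdd v)))).toAdd = f u v - f v u) :
    IsIsoclinic G (BilinExt f) := by
  refine IsIsoclinic.of_hom ((e : Multiplicative V →* G ⧸ center G).comp (proj f))
    ((incl f).comp (d : commutator G →* Multiplicative W)) ?_ ?_ ?_ ?_ fun a b => ?_
  · intro x
    refine ⟨⟨(e.symm x).toAdd, 0⟩, ?_⟩
    exact e.apply_symm_apply x
  · ext a
    rw [mem_center_iff_fst_eq_zero hf, MonoidHom.mem_ker]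
    exact (map_eq_one_iff e e.injective).trans Iff.rfl
  · intro a b hab
    exact d.injective (congrArg snd hab)
  · ext a
    rw [mem_commutator_iff_fst_eq_zero hf]
    constructor
    · rintro ⟨c, rfl⟩
      rfl
    · intro ha
      refine ⟨d.symm (.ofAdd a.snd), ?_⟩
      ext
      · exact ha.symm
      · exact congrArg Multiplicative.toAdd (d.apply_symm_apply (.ofAdd a.snd))
  · rw [commutatorElement_eq, ← hed]
    rfl

end BilinExt

/-! ### Alternating maps as antisymmetrizations -/

/-- An alternating bilinear map is the antisymmetrization of a bilinear map, in every
characteristic. -/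
theorem exists_sub_flip_eq {K V W : Type*} [Field K] [AddCommGroup V] [AddCommGroup W] [Module K V]
    [Module K W] (ω : V →ₗ[K] V →ₗ[K] W) (hω : ∀ v, ω v v = 0) :
    ∃ f : V →ₗ[K] V →ₗ[K] W, ∀ u v, f u v - f v u = ω u v := by
  classical
  let B := Module.Basis.ofVectorSpace K V
  let _ : LinearOrder (Module.Basis.ofVectorSpaceIndex K V) := WellOrderingRel.isWellOrder.linearOrder
  -- The strictly upper triangular half of `ω` in an arbitrarily ordered basis. This avoids dividing
  -- by 2.
  let f : V →ₗ[K] V →ₗ[K] W :=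
    B.constr K fun i => B.constr K fun j => if i < j then ω (B i) (B j) else 0
  have hf : ∀ i j, f (B i) (B j) = if i < j then ω (B i) (B j) else 0 := by
    intro i j
    simp only [f, Module.Basis.constr_basis]
  have hneg : ∀ u v, ω u v = - ω v u := by
    intro u v
    have := hω (u + v)
    simp only [map_add, LinearMap.add_apply, hω, zero_add, add_zero] at this
    exact eq_neg_of_add_eq_zero_right this
  have key : f - f.flip = ω := by
    refine B.ext fun i => B.ext fun j => ?_
    rw [LinearMap.sub_apply, LinearMap.sub_apply, LinearMap.flip_apply, hf, hf]
    rcases lt_trichotomy i j with h | rfl | h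
    · simp [h, h.not_gt]
    · simp [hω]
    · simp only [h, h.not_gt, if_true, if_false, zero_sub]
      exact (hneg _ _).symm
  exact ⟨f, fun u v => by rw [← key]; rfl⟩

theorem exists_sub_flip_eq_of_prime_nsmul {V W : Type*} [AddCommGroup V] [AddCommGroup W] {p : ℕ}
    [Fact p.Prime] (hV : ∀ v : V, p • v = 0) (hW : ∀ w : W, p • w = 0) (B : V →+ V →+ W)
    (hB : ∀ v, B v v = 0) : ∃ f : V →+ V →+ W, ∀ u v, f u v - f v u = B u v := by
  have : Module (ZMod p) V := AddCommGroup.zmodModule hV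
  have : Module (ZMod p) W := AddCommGroup.zmodModule hW
  let ω : V →ₗ[ZMod p] V →ₗ[ZMod p] W := LinearMap.mk₂ (ZMod p) (fun u v => B u v)
    (fun u v w => by simp) (fun c u v => ZMod.map_smul (B.flip v) c u)
    (fun u v w => by simp) (fun c u v => ZMod.map_smul (B u) c v)
  obtain ⟨f, hf⟩ := exists_sub_flip_eq ω hB
  refine ⟨AddMonoidHom.mk' (fun u => (f u).toAddMonoidHom) fun u v => ?_, hf⟩
  ext w
  simp

/-! ### Groups whose noncentral classes have the size of the commutator subgroup -/

/-- The map `t ↦ x * t⁻¹` embeds the class of `x` into `γ₂(G)` with commutators `[x, g]` as values;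
equal cardinality makes it onto. -/
theorem exists_commutatorElement_eq {G : Type*} [Group G] [Finite G] {x : G}
    (hx : (conjugatesOf x).ncard = Nat.card (commutator G)) {c : G} (hc : c ∈ commutator G) :
    ∃ g, ⁅x, g⁆ = c := by
  have hsub : (fun t => x * t⁻¹) '' conjugatesOf x ⊆ commutator G := by
    rintro _ ⟨t, ht, rfl⟩
    obtain ⟨g, rfl⟩ := mem_conjugatesOf_iff.1 ht
    have h : x * (g * x * g⁻¹)⁻¹ = ⁅x, g⁆ := by rw [commutatorElement_def]; group
    simp only [h]
    exact commutator_mem_commutator (mem_top _) (mem_top _)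
  have hinj : Function.Injective fun t : G => x * t⁻¹ := fun a b h => by simpa using h
  have heq := Set.eq_of_subset_of_ncard_le hsub (by
    rw [Set.ncard_image_of_injective _ hinj, hx, ← Nat.card_coe_set_eq]
    rfl)
  obtain ⟨t, ht, rfl⟩ := heq.symm.subset hc
  obtain ⟨g, rfl⟩ := mem_conjugatesOf_iff.1 ht
  exact ⟨g, by rw [commutatorElement_def]; group⟩

section ClassTwo

variable {G : Type*} [Group G] (hcl : commutator G ≤ center G)
include hcl

theorem commutatorElement_mul_left_of_le_center (a b c : G) : ⁅a * b, c⁆ = ⁅a, c⁆ * ⁅b, c⁆ := by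
  have h : ⁅b, c⁆ ∈ center G := hcl (commutator_mem_commutator (mem_top _) (mem_top _))
  have h1 := mem_center_iff.1 h
  calc ⁅a * b, c⁆ = a * ⁅b, c⁆ * (c * a⁻¹ * c⁻¹) := by
        simp only [commutatorElement_def]; group
    _ = ⁅a, c⁆ * ⁅b, c⁆ := by
        rw [mul_assoc, ← h1, commutatorElement_def a c]; group

theorem commutatorElement_mul_right_of_le_center (a b c : G) : ⁅a, b * c⁆ = ⁅a, b⁆ * ⁅a, c⁆ := by
  have h : ⁅c, a⁆ ∈ center G := hcl (commutator_mem_commutator (mem_top _) (mem_top _))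
  rw [← commutatorElement_inv, commutatorElement_mul_left_of_le_center hcl, mul_inv_rev,
    commutatorElement_inv, commutatorElement_inv, ← commutatorElement_inv c a]
  exact (mem_center_iff.1 (inv_mem h) _).symm

theorem commutatorMap_mul_left (x y z : G ⧸ center G) :
    commutatorMap G (x * y) z = commutatorMap G x z * commutatorMap G y z := by
  obtain ⟨a, rfl⟩ := QuotientGroup.mk_surjective x
  obtain ⟨b, rfl⟩ := QuotientGroup.mk_surjective y
  obtain ⟨c, rfl⟩ := QuotientGroup.mk_surjective z
  exact Subtype.ext (commutatorElement_mul_left_of_le_center hcl a b c)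

theorem commutatorMap_mul_right (x y z : G ⧸ center G) :
    commutatorMap G x (y * z) = commutatorMap G x y * commutatorMap G x z := by
  obtain ⟨a, rfl⟩ := QuotientGroup.mk_surjective x
  obtain ⟨b, rfl⟩ := QuotientGroup.mk_surjective y
  obtain ⟨c, rfl⟩ := QuotientGroup.mk_surjective z
  exact Subtype.ext (commutatorElement_mul_right_of_le_center hcl a b c)

theorem commutatorElement_pow_left_of_le_center (a b : G) (n : ℕ) : ⁅a ^ n, b⁆ = ⁅a, b⁆ ^ n := by
  induction n with
  | zero => simp
  | succ n ih => rw [pow_succ, pow_succ, commutatorElement_mul_left_of_le_center hcl, ih]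

end ClassTwo

/-- If every noncentral class is a coset of the commutator subgroup and `G/Z(G)` is a `p`-group,
then `G` is isoclinic to a Camina special `p`-group. -/
theorem exists_isIsoclinic_special {G : Type u} [Group G] [Finite G] {p : ℕ} [Fact p.Prime]
    (hp : IsPGroup p (G ⧸ center G)) (hG : center G ≠ ⊤)
    (h : ∀ x ∉ center G, (conjugatesOf x).ncard = Nat.card (commutator G)) :
    ∃ (H : Type u) (_ : Group H), Finite H ∧ IsIsoclinic G H ∧ IsCamina H ∧
      IsSpecialPGroup p H := by
  have hsurj : ∀ x ∉ center G, ∀ c ∈ commutator G, ∃ g, ⁅x, g⁆ = c := fun x hx c hc =>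
    exists_commutatorElement_eq (h x hx) hc
  -- A noncentral `x` in `γ₂(G)` would itself be some `[x, g]`; cancelling `x` leaves a conjugate of
  -- `x⁻¹` equal to `1`.
  have hcl : commutator G ≤ center G := by
    intro x hx
    by_contra hxZ
    obtain ⟨g, hg⟩ := hsurj x hxZ x hx
    have h1 : g * x⁻¹ * g⁻¹ = 1 := by
      rw [commutatorElement_def, mul_assoc, mul_assoc, mul_eq_left] at hg
      rwa [mul_assoc]
    rw [conj_eq_one_iff, inv_eq_one] at h1
    exact hxZ (h1 ▸ one_mem _)
  have hnt : Nontrivial (G ⧸ center G) := QuotientGroup.nontrivial_iff.2 hG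
  -- exponents
  obtain ⟨x₀, hx₀, hx₀p⟩ : ∃ x ∉ center G, x ^ p ∈ center G := by
    obtain ⟨k, hk⟩ := hp.exists_card_eq
    have hdvd : p ∣ Nat.card (G ⧸ center G) := by
      rw [hk]
      refine dvd_pow_self p ?_
      rintro rfl
      exact (Finite.one_lt_card_iff_nontrivial.2 hnt).ne' (by rw [hk, pow_zero])
    obtain ⟨y, hy⟩ := exists_prime_orderOf_dvd_card' p hdvd
    obtain ⟨x, rfl⟩ := QuotientGroup.mk_surjective y
    refine ⟨x, fun hx => ?_, ?_⟩
    · rw [(QuotientGroup.eq_one_iff x).2 hx, orderOf_one] at hy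
      exact (Fact.out : p.Prime).one_lt.ne hy
    · rw [← QuotientGroup.eq_one_iff, QuotientGroup.mk_pow, ← hy, pow_orderOf_eq_one]
  -- Every `c` is `[x₀, g]` for the one fixed `x₀`, and `[x₀, g] ^ p = [x₀ ^ p, g] = 1`. The
  -- exponent of `G/Z` then follows from that of `γ₂(G)`.
  have hWp : ∀ c ∈ commutator G, c ^ p = 1 := by
    intro c hc
    obtain ⟨g, rfl⟩ := hsurj x₀ hx₀ c hc
    rw [← commutatorElement_pow_left_of_le_center hcl, commutatorElement_eq_one_iff_mul_comm]
    exact (mem_center_iff.1 hx₀p g).symm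
  have hVp : ∀ x : G, x ^ p ∈ center G := by
    intro x
    rw [mem_center_iff]
    intro g
    rw [eq_comm, ← commutatorElement_eq_one_iff_mul_comm,
      commutatorElement_pow_left_of_le_center hcl]
    exact hWp _ (commutator_mem_commutator (mem_top _) (mem_top _))
  let _ : CommGroup (G ⧸ center G) :=
    { (inferInstance : Group (G ⧸ center G)) with
      mul_comm := by
        intro x y
        obtain ⟨a, rfl⟩ := QuotientGroup.mk_surjective x
        obtain ⟨b, rfl⟩ := QuotientGroup.mk_surjective y
        rw [← commutatorElement_eq_one_iff_mul_comm]
        exact (QuotientGroup.eq_one_iff ⁅a, b⁆).2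
          (hcl (commutator_mem_commutator (mem_top _) (mem_top _))) }
  let _ : CommGroup (commutator G) :=
    { (inferInstance : Group (commutator G)) with
      mul_comm := fun a b => Subtype.ext (mem_center_iff.1 (hcl b.2) a) }
  let V := Additive (G ⧸ center G)
  let W := Additive (commutator G)
  have hV : ∀ v : V, p • v = 0 := by
    intro v
    obtain ⟨a, ha⟩ := QuotientGroup.mk_surjective v.toMul
    have h1 : v.toMul ^ p = 1 := by
      rw [← ha, ← QuotientGroup.mk_pow]
      exact (QuotientGroup.eq_one_iff _).2 (hVp a)
    exact h1
  have hW : ∀ w : W, p • w = 0 := fun w => Subtype.ext (hWp w.toMul w.toMul.2)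
  let B : V →+ V →+ W :=
    AddMonoidHom.mk' (fun u => AddMonoidHom.mk' (fun v => .ofMul (commutatorMap G u.toMul v.toMul))
      fun v w => commutatorMap_mul_right hcl u.toMul v.toMul w.toMul)
      fun u v => AddMonoidHom.ext fun w => commutatorMap_mul_left hcl u.toMul v.toMul w.toMul
  have hB : ∀ v, B v v = 0 := by
    intro v
    obtain ⟨a, ha⟩ := QuotientGroup.mk_surjective v.toMul
    refine Subtype.ext ?_
    change (commutatorMap G v.toMul v.toMul : G) = 1
    rw [← ha]
    exact commutatorElement_self a
  obtain ⟨F, hF⟩ := exists_sub_flip_eq_of_prime_nsmul hV hW B hB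
  have hFsurj : ∀ v ≠ 0, ∀ w, ∃ u, F v u - F u v = w := by
    intro v hv w
    obtain ⟨a, ha⟩ := QuotientGroup.mk_surjective v.toMul
    have haZ : a ∉ center G := fun hc => hv (ha.symm.trans ((QuotientGroup.eq_one_iff a).2 hc))
    obtain ⟨g, hg⟩ := hsurj a haZ w.toMul w.toMul.2
    refine ⟨Additive.ofMul (g : G ⧸ center G), ?_⟩
    rw [hF]
    refine Subtype.ext ?_
    change (commutatorMap G v.toMul (g : G ⧸ center G) : G) = w.toMul
    rw [← ha]
    exact hg
  have hVnt : Nontrivial V := hnt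
  have hWnt : Nontrivial W := by
    by_contra hcon
    rw [not_nontrivial_iff_subsingleton] at hcon
    refine hx₀ (mem_center_iff.2 fun g => ?_)
    rw [eq_comm, ← commutatorElement_eq_one_iff_mul_comm]
    exact congrArg Subtype.val (hcon.elim (Additive.ofMul
      ⟨⁅x₀, g⁆, commutator_mem_commutator (mem_top _) (mem_top _)⟩) 0)
  have hVfin : Finite V := inferInstanceAs (Finite (G ⧸ center G))
  have hWfin : Finite W := inferInstanceAs (Finite (commutator G))
  refine ⟨BilinExt F, inferInstance, inferInstance, ?_, BilinExt.isCamina hFsurj,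
    BilinExt.isPGroup hV hW, BilinExt.center_eq_commutator hFsurj,
    BilinExt.commutator_eq_frattini hFsurj hV⟩
  exact BilinExt.isIsoclinic hFsurj (MulEquiv.refl (G ⧸ center G)) (MulEquiv.refl (commutator G))
    fun u v => (hF u v).symm

/-! ### Assembly of the two conclusions -/

theorem mainTheorem9 {G : Type u} [Group G] [Finite G]
    (hG : ¬ ∀ x y : G, x * y = y * x)
    (hPr : commProb G = 1 / (maxConjClassSize G : ℚ) *
      (1 + ((maxConjClassSize G : ℚ) - 1) / ((Subgroup.center G).index : ℚ))) :
    ∃ p r : ℕ, p.Prime ∧ 0 < r ∧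
      (∃ (H : Type u) (_ : Group H), Finite H ∧ IsPGroup p H ∧ IsIsoclinic G H ∧
        conjClassSizes H = {1, p ^ r}) ∧
      (maxConjClassSize G = Nat.card (commutator G) →
        ∃ (H : Type u) (_ : Group H), Finite H ∧ IsIsoclinic G H ∧
          IsCamina H ∧ IsSpecialPGroup p H) := by
  have hZ : center G ≠ ⊤ := fun htop =>
    hG fun x y => mem_center_iff.1 (htop ▸ mem_top y) x
  have hidx := index_centralizer_of_commProb_eq hPr
  obtain ⟨p, hp, hpG⟩ := isPGroup_quotient_center hidx hZ
  have := Fact.mk hp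
  obtain ⟨r, hr, hb⟩ := eq_prime_pow_of_isPGroup_quotient_center hidx hZ hpG
  refine ⟨p, r, hp, hr, ?_, fun hγ => ?_⟩
  · let P : Sylow p G := default
    refine ⟨(P : Subgroup G), inferInstance, inferInstance, P.2,
      isIsoclinic_of_sup_center (P.exists_mul_center hpG), ?_⟩
    rw [conjClassSizes_subgroup (P.exists_mul_center hpG),
      conjClassSizes_eq_of_index_centralizer hidx hZ, hb]
  · exact exists_isIsoclinic_special hpG hZ fun x hx => by
      rw [ncard_conjugatesOf, hidx x hx, hγ]
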